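/- Let $\mathcal{T}$ be an ideal triangulation, with $N\ge 2$ oriented tetrahedra whose faces are glued in pairs by orientation-reversing maps, of a connected orientable 3-manifold that is the interior of a compact manifold whose boundary is a nonempty union of tori. Let $Q(\mathcal{T})$ be the set of its $3N$ normal quadrilateral types, three in each tetrahedron. For an edge class $E$ and $\square\in Q(\mathcal{T})$, let $G(E,\square)\in\{0,1,2\}$ be the number of tetrahedral edges in $E$ facing $\square$. Let $\mathcal{SA}(\mathcal{T})$ be the set of all $\omega:Q(\mathcal{T})\to S^1$ such that $\omega(\square)\,\omega(\square')\,\omega(\square'')=-1$ for the three quads $\square,\square',\square''$ of every tetrahedron, and $\prod_{\square\in Q(\mathcal{T})}\omega(\square)^{G(E,\square)}=1$ for every edge $E$. For $0<|q|<1$ put $(z;q)_\infty=\prod_{n\ge0}(1-q^nz)$, $\;c_q=(q;q)_\infty^2/(q^2;q^2)_\infty$ and $G_q(z)=(-qz^{-1};q)_\infty/(z;q)_\infty$. Fix arbitrary constants $a(\square)\in(0,1)$, $\square\in Q(\mathcal{T})$. For $\omega\in\mathcal{SA}(\mathcal{T})$, $\hbar<0$ and $q=e^{\hbar}$ set $$b_\omega(\hbar)=c_q^N\prod_{\square\in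 Q(\mathcal{T})}G_q\bigl(\omega(\square)\,e^{a(\square)\hbar}\bigr).$$ This is the integrand of the state integral of the meromorphic 3D-index. Let $\Delta$ be a tetrahedron with $S^1$-valued angles, i.e. numbers $\omega,\omega',\omega''\in S^1$ with $\omega\omega'\omega''=-1$ assigned to its three quads. We call $\Delta$ *non-suppressing* if $1\in\{\omega,\omega',\omega''\}$, or the imaginary parts of $\omega,\omega',\omega''$ are all positive, or they are all negative; otherwise $\Delta$ is *suppressing*. **Proposition.** For every fixed $\omega\in\mathcal{SA}(\mathcal{T})$ and all fixed constants $a(\square)\in(0,1)$, the value $b_\omega(-1/\kappa)$ decays exponentially as $\kappa\to+\infty$ (i.e. $b_\omega(-1/\kappa)=O(e^{-\varepsilon\kappa})$ for some $\varepsilon>0$) if and only if $\mathcal{T}$ contains a tetrahedron that is suppressing for $\omega$. **Lemma.** For every tetrahedron with $S^1$-valued angles $\omega,\omega',\omega''$, $$|\operatorname{Arg}\omega|+|\operatorname{Arg}\omega'|+|\operatorname{Arg}\omega''|\ge\pi,$$ where $\operatorname{Arg}$ is the principal argument, and the inequality is strict if and only if the tetrahedron is suppressing. -/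

import Mathlib

noncomputable section

/-- An oriented face-pairing of `N` tetrahedra with vertices labelled `0, 1, 2, 3`, each oriented by
the order of its labels. The face of `t` opposite to its vertex `f` is glued to the face of the
tetrahedron `adj t f` opposite to the vertex `perm t f f`, by the affine map sending each vertex
`v ≠ f` of `t` to the vertex `perm t f v` of `adj t f`. Every face is glued to exactly one other
face. With the label orientations, the gluing map of two faces reverses their boundary
orientations exactly when the permutation `perm t f` is odd. -/
structure OrientedGluing (N : ℕ) where
  adj : Fin N → Fin 4 → Fin N
  perm : Fin N → Fin 4 → Equiv.Perm (Fin 4)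
  adj_adj : ∀ t f, adj (adj t f) (perm t f f) = t
  perm_adj : ∀ t f, perm (adj t f) (perm t f f) = (perm t f)⁻¹
  distinct_faces : ∀ t f, (adj t f, perm t f f) ≠ (t, f)
  orientation_reversing : ∀ t f, Equiv.Perm.sign (perm t f) = -1

namespace OrientedGluing

variable {N : ℕ} (T : OrientedGluing N)

/-- The edges of a single tetrahedron: two-element sets of vertices. -/
abbrev LocalEdge : Type := {e : Finset (Fin 4) // e.card = 2}

/-- The edges of the unglued tetrahedra. -/
abbrev TetEdge (N : ℕ) : Type := Fin N × LocalEdge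

/-- Two tetrahedral edges are matched by the gluing of a face that contains them. -/
def EdgeRel (x y : TetEdge N) : Prop :=
  ∃ f : Fin 4, f ∉ x.2.1 ∧ y.1 = T.adj x.1 f ∧ y.2.1 = x.2.1.map (T.perm x.1 f).toEmbedding

/-- The edges of the triangulation: classes of tetrahedral edges, for the equivalence relation
generated by the gluings. -/
def Edge : Type := Quot T.EdgeRel

/-- The normal quadrilateral types. The quad `(t, i)` of the tetrahedron `t` separates the vertices
`0, i + 1` from the other two; it faces the edge `{0, i + 1}` and the edge opposite to it. -/
abbrev Quad (N : ℕ) : Type := Fin N × Fin 3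

/-- The tetrahedral edge `x` faces the quad `s`. -/
def Faces (x : TetEdge N) (s : Quad N) : Prop :=
  x.1 = s.1 ∧ (x.2.1 = {0, s.2.succ} ∨ x.2.1 = {0, s.2.succ}ᶜ)

/-- The incidence number `G(E, s)`: how many tetrahedral edges facing the quad `s` belong to `E`. -/
def incidence (E : T.Edge) (s : Quad N) : ℕ :=
  {x : TetEdge N | Faces x s ∧ Quot.mk T.EdgeRel x = E}.ncard

/-- Corners `(t, v)` of tetrahedra; they are the triangles of the vertex links. -/
abbrev Corner (N : ℕ) : Type := Fin N × Fin 4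

/-- Two corners are matched by the gluing of a face that contains them. -/
def CornerRel (x y : Corner N) : Prop :=
  ∃ f : Fin 4, f ≠ x.2 ∧ y = (T.adj x.1 f, T.perm x.1 f x.2)

/-- The ideal vertices. -/
def IdealVertex : Type := Quot T.CornerRel

/-- A corner with a second vertex label `k` of the same tetrahedron. It stands either for the end at
the corner of the edge going to `k` (a vertex of the link triangle), or for the angle at the corner
of the face opposite to `k` (a side of the link triangle). -/
abbrev Flag (N : ℕ) : Type := {x : Corner N × Fin 4 // x.1.2 ≠ x.2}

/-- Vertices of two link triangles that are matched by the gluing of a face containing both ends of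
the tetrahedral edge in question. -/
def LinkVertexRel (x y : Flag N) : Prop :=
  ∃ f : Fin 4, f ≠ x.1.1.2 ∧ f ≠ x.1.2 ∧
    y.1 = ((T.adj x.1.1.1 f, T.perm x.1.1.1 f x.1.1.2), T.perm x.1.1.1 f x.1.2)

/-- Sides of two link triangles that are glued to each other. -/
def LinkSideRel (x y : Flag N) : Prop :=
  y.1 = ((T.adj x.1.1.1 x.1.2, T.perm x.1.1.1 x.1.2 x.1.1.2), T.perm x.1.1.1 x.1.2 x.1.2)

/-- The flags located at the ideal vertex `V`. -/
def flagsAt (V : T.IdealVertex) : Set (Flag N) :=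
  {x | Quot.mk T.CornerRel x.1.1 = V}

/-- The Euler characteristic of the link of an ideal vertex: vertices minus edges plus triangles. -/
def linkEulerChar (V : T.IdealVertex) : ℤ :=
  ((Quot.mk T.LinkVertexRel '' T.flagsAt V).ncard : ℤ)
    - ((Quot.mk T.LinkSideRel '' T.flagsAt V).ncard : ℤ)
    + ({x : Corner N | Quot.mk T.CornerRel x = V}.ncard : ℤ)

end OrientedGluing

/-- An ideal triangulation, with `N ≥ 2` tetrahedra, of a connected oriented 3-manifold that is the
interior of a compact manifold whose boundary is a nonempty union of tori. The complement of the
vertices in an oriented gluing is an oriented 3-manifold whose ends are products of the vertex links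
with a ray. The links are connected closed oriented surfaces, so they are tori exactly when their
Euler characteristics vanish. -/
structure IdealTriangulation (N : ℕ) extends OrientedGluing N where
  two_le : 2 ≤ N
  connected : ∀ s t : Fin N, Relation.ReflTransGen (fun u v => ∃ f, adj u f = v) s t
  toroidal : ∀ V : toOrientedGluing.IdealVertex, toOrientedGluing.linkEulerChar V = 0

/-- The tetrahedral condition on a triple of circle-valued angles: their product is `-1`. -/
def IsAngledTetrahedron (θ : Fin 3 → Circle) : Prop :=
  ∏ i, (θ i : ℂ) = -1

/-- Non-suppressing: some angle is `1`, or all imaginary parts are positive, or all are negative. -/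
def NonSuppressing (θ : Fin 3 → Circle) : Prop :=
  (∃ i, θ i = 1) ∨ ((∀ i, 0 < (θ i : ℂ).im) ∨ (∀ i, (θ i : ℂ).im < 0))

/-- Suppressing: not non-suppressing. -/
def Suppressing (θ : Fin 3 → Circle) : Prop :=
  ¬ NonSuppressing θ

namespace IdealTriangulation

variable {N : ℕ} (T : IdealTriangulation N)

/-- The set of circle-valued angle structures on `T`. -/
def circleAngleStructures : Set (OrientedGluing.Quad N → Circle) :=
  {ω | (∀ t : Fin N, IsAngledTetrahedron (fun i => ω (t, i))) ∧
    ∀ E : T.toOrientedGluing.Edge,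
      ∏ s : OrientedGluing.Quad N, ω s ^ T.toOrientedGluing.incidence E s = 1}

end IdealTriangulation

/-- The `q`-Pochhammer symbol `(z; q)_∞`, for `|q| < 1`. -/
def qPoch (z q : ℂ) : ℂ :=
  ∏' n : ℕ, (1 - q ^ n * z)

/-- The constant `c_q = (q; q)_∞ ^ 2 / (q ^ 2; q ^ 2)_∞`. -/
def cConst (q : ℂ) : ℂ :=
  qPoch q q ^ 2 / qPoch (q ^ 2) (q ^ 2)

/-- The function `G_q(z) = (-q / z; q)_∞ / (z; q)_∞`. -/
def GFun (q z : ℂ) : ℂ :=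
  qPoch (-q * z⁻¹) q / qPoch z q

/-- The integrand `b_ω(ℏ)` of the state integral of the meromorphic 3D-index, with `q = exp ℏ`. -/
def stateIntegrand {N : ℕ} (a : OrientedGluing.Quad N → ℝ) (ω : OrientedGluing.Quad N → Circle)
    (ℏ : ℂ) : ℂ :=
  cConst (Complex.exp ℏ) ^ N *
    ∏ s : OrientedGluing.Quad N, GFun (Complex.exp ℏ) ((ω s : ℂ) * Complex.exp ((a s : ℂ) * ℏ))

/-- `g(κ)` decays exponentially as `κ → +∞`: it is `O(exp (-ε κ))` for some `ε > 0`. -/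
def DecaysExponentially (g : ℝ → ℂ) : Prop :=
  ∃ ε : ℝ, 0 < ε ∧ g =O[Filter.atTop] fun κ : ℝ => Real.exp (-(ε * κ))

end

open Filter Topology

/-! Put `q = exp (-1/κ)`. For `|w| = 1` and `a > 0`, the logarithm of `|(w q^a; q)_∞|` is `-κ (Re
Li₂(w) + o(1))` (`hasExpRate_qPoch`), and on the circle `Re Li₂(e^{iθ})` is quadratic in `|θ|`. In
`G_q` the `θ²` terms of numerator and denominator cancel, leaving the rate `π²/4 - (π/2)|Arg ω|` per
quad; `c_q` contributes `-π²/4` per tetrahedron. The integrand thus has exact rate `(π/2) ∑_t (π -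
∑_i |Arg ω_i|)`, and it decays exponentially iff this is negative. Every summand is nonpositive: the
three arguments add up to an odd multiple of `π`, so the triangle inequality applies. Its equality
case is exactly the non-suppressing one (`sum_abs_arg_eq_pi_iff`), so the rate is negative iff some
tetrahedron is suppressing. -/

/-- The logarithmic expansion of the `q`-Pochhammer symbol. -/
theorem qPoch_eq_exp {z q : ℂ} (hz : ‖z‖ < 1) (hq : ‖q‖ < 1) :
    qPoch z q = Complex.exp (-∑' k : ℕ, z ^ k / (k * (1 - q ^ k))) := by
  have hlt : ∀ n : ℕ, ‖q ^ n * z‖ < 1 := fun n => by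
    rw [norm_mul, norm_pow]
    exact (mul_le_of_le_one_left (norm_nonneg _)
      (pow_le_one₀ (norm_nonneg _) hq.le)).trans_lt hz
  have hne : ∀ n : ℕ, 1 - q ^ n * z ≠ 0 := fun n h => by
    have h1 := hlt n
    rw [← sub_eq_zero.mp h, norm_one] at h1
    exact lt_irrefl _ h1
  have hsum : Summable (fun n : ℕ => q ^ n * z) :=
    (summable_geometric_of_norm_lt_one hq).mul_right z
  have hlog : Summable (fun n : ℕ => Complex.log (1 - q ^ n * z)) := by
    simpa [sub_eq_add_neg] using Complex.summable_log_one_add_of_summable hsum.neg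
  have htaylor : ∀ n : ℕ, Complex.log (1 - q ^ n * z) = -∑' k : ℕ, (q ^ n * z) ^ k / k :=
    fun n => by rw [(Complex.hasSum_taylorSeries_neg_log (hlt n)).tsum_eq, neg_neg]
  have hdouble : Summable (Function.uncurry fun n k : ℕ => (q ^ n * z) ^ k / (k : ℂ)) := by
    refine Summable.of_norm_bounded
      (g := fun p : ℕ × ℕ => ‖q‖ ^ p.1 * ‖z‖ ^ p.2) ?_ ?_
    · exact (summable_geometric_of_lt_one (norm_nonneg _) hq).mul_of_nonneg
        (summable_geometric_of_lt_one (norm_nonneg _) hz)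
        (fun _ => by positivity) (fun _ => by positivity)
    · rintro ⟨n, k⟩
      -- The term `k = 0` is `0` because division by zero gives `0`.
      rcases Nat.eq_zero_or_pos k with rfl | hk
      · simp only [Function.uncurry, Nat.cast_zero, div_zero, norm_zero]
        positivity
      · have hk1 : (1 : ℝ) ≤ k := by exact_mod_cast hk
        simp only [Function.uncurry, norm_div, norm_pow, norm_mul, Complex.norm_natCast]
        rw [mul_pow]
        refine (div_le_self (by positivity) hk1).trans ?_
        gcongr
        exact pow_le_of_le_one (by positivity) (pow_le_one₀ (norm_nonneg _) hq.le) hk.ne'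
  rw [qPoch, ← Complex.cexp_tsum_eq_tprod hne hlog]
  congr 1
  simp_rw [htaylor]
  -- After the swap, the sum over `n` is geometric with ratio `q ^ k`.
  rw [tsum_neg, ← hdouble.tsum_comm']
  · congr 2
    ext k
    rcases Nat.eq_zero_or_pos k with rfl | hk
    · simp
    · have hqk : ‖q ^ k‖ < 1 := by
        rw [norm_pow]; exact pow_lt_one₀ (norm_nonneg _) hq hk.ne'
      have : ∀ n : ℕ, (q ^ n * z) ^ k / (k : ℂ) = (z ^ k / k) * (q ^ k) ^ n := fun n => by
        rw [mul_pow, ← pow_mul, ← pow_mul, mul_comm n k]; ring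
      simp_rw [this]
      rw [tsum_mul_left, tsum_geometric_of_norm_lt_one hqk, div_mul_eq_div_div,
        div_eq_mul_inv _ (1 - q ^ k)]
  · exact fun n => hdouble.prod_factor n
  · exact fun k => hdouble.prod_symm.prod_factor k

/-- The weight `exp (-a u) u / (1 - exp (-u))` interpolating between the exact expansion of
`(w q ^ a; q)_∞` and its leading asymptotics. -/
noncomputable def expWeight (a u : ℝ) : ℝ :=
  Real.exp (-(a * u)) * (u / (1 - Real.exp (-u)))

theorem tendsto_expWeight (a : ℝ) : Tendsto (expWeight a) (𝓝[>] 0) (𝓝 1) := by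
  have hd : HasDerivAt (fun u : ℝ => 1 - Real.exp (-u)) 1 0 := by
    simpa using ((hasDerivAt_neg (0 : ℝ)).exp).const_sub 1
  have hs := (hasDerivAt_iff_tendsto_slope.mp hd).inv₀ one_ne_zero
  have hs' := hs.mono_left (nhdsWithin_mono (0 : ℝ) (fun x (hx : (0 : ℝ) < x) => hx.ne'))
  have he : Tendsto (fun u : ℝ => Real.exp (-(a * u))) (𝓝[>] 0) (𝓝 1) := by
    have : Continuous fun u : ℝ => Real.exp (-(a * u)) := by fun_prop
    simpa using (this.tendsto 0).mono_left nhdsWithin_le_nhds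
  have := he.mul hs'
  simp only [inv_one, mul_one] at this
  refine this.congr fun u => ?_
  simp [expWeight, slope_def_field]

/-- Supplies the uniform bound for dominated convergence. Both exponentials are controlled by `exp
(-x) ≤ 1 / (1 + x)`; `a > 0` compensates the linear growth of `u / (1 - exp (-u))`. -/
theorem abs_expWeight_le {a u : ℝ} (ha : 0 < a) (hu : 0 < u) :
    |expWeight a u| ≤ 1 + 1 / a := by
  have h1 : Real.exp (-u) ≤ 1 / (1 + u) := by
    rw [Real.exp_neg, ← one_div]
    exact one_div_le_one_div_of_le (by positivity) (by linarith [Real.add_one_le_exp u])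
  have h2 : Real.exp (-(a * u)) ≤ 1 / (1 + a * u) := by
    rw [Real.exp_neg, ← one_div]
    exact one_div_le_one_div_of_le (by positivity) (by linarith [Real.add_one_le_exp (a * u)])
  have h3 : u / (1 + u) ≤ 1 - Real.exp (-u) := by
    have : u / (1 + u) = 1 - 1 / (1 + u) := by field_simp; ring
    linarith
  have h4 : 0 < u / (1 + u) := by positivity
  have h5 : u / (1 - Real.exp (-u)) ≤ 1 + u := by
    rw [div_le_iff₀ (h4.trans_le h3)]
    calc u = (1 + u) * (u / (1 + u)) := by field_simp
      _ ≤ _ := by gcongr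
  have h6 : 0 ≤ u / (1 - Real.exp (-u)) := div_nonneg hu.le (h4.trans_le h3).le
  rw [expWeight, abs_of_nonneg (mul_nonneg (Real.exp_pos _).le h6)]
  calc _ ≤ 1 / (1 + a * u) * (1 + u) := mul_le_mul h2 h5 h6 (by positivity)
    _ ≤ 1 + 1 / a := by
      rw [one_div_mul_eq_div, div_le_iff₀ (by positivity)]
      have : (1 + 1 / a) * (1 + a * u) = 1 + u + (a * u + 1 / a) := by field_simp; ring
      have : 0 < a * u + 1 / a := by positivity
      linarith

/-! ### Exponential rates -/

/-- `g` is eventually nonzero and `|g κ| = exp (κ (L + o(1)))` as `κ → +∞`. -/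
def HasExpRate (g : ℝ → ℂ) (L : ℝ) : Prop :=
  (∀ᶠ κ in atTop, g κ ≠ 0) ∧ Tendsto (fun κ => Real.log ‖g κ‖ / κ) atTop (𝓝 L)

namespace HasExpRate

variable {f g : ℝ → ℂ} {L M : ℝ}

theorem mul (hf : HasExpRate f L) (hg : HasExpRate g M) :
    HasExpRate (fun κ => f κ * g κ) (L + M) := by
  refine ⟨by filter_upwards [hf.1, hg.1] with κ h1 h2 using mul_ne_zero h1 h2,
    (hf.2.add hg.2).congr' ?_⟩
  filter_upwards [hf.1, hg.1] with κ h1 h2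
  rw [norm_mul, Real.log_mul (norm_ne_zero_iff.mpr h1) (norm_ne_zero_iff.mpr h2), add_div]

theorem div (hf : HasExpRate f L) (hg : HasExpRate g M) :
    HasExpRate (fun κ => f κ / g κ) (L - M) := by
  refine ⟨by filter_upwards [hf.1, hg.1] with κ h1 h2 using div_ne_zero h1 h2,
    (hf.2.sub hg.2).congr' ?_⟩
  filter_upwards [hf.1, hg.1] with κ h1 h2
  rw [norm_div, Real.log_div (norm_ne_zero_iff.mpr h1) (norm_ne_zero_iff.mpr h2), sub_div]

theorem pow (hf : HasExpRate f L) (n : ℕ) : HasExpRate (fun κ => f κ ^ n) (n * L) := by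
  refine ⟨by filter_upwards [hf.1] with κ h1 using pow_ne_zero n h1,
    (hf.2.const_mul (n : ℝ)).congr fun κ => ?_⟩
  rw [norm_pow, Real.log_pow, mul_div_assoc]

theorem prod {ι : Type*} (s : Finset ι) {f : ι → ℝ → ℂ} {L : ι → ℝ}
    (hf : ∀ i, HasExpRate (f i) (L i)) :
    HasExpRate (fun κ => ∏ i ∈ s, f i κ) (∑ i ∈ s, L i) := by
  classical
  induction s using Finset.induction_on with
  | empty => exact ⟨by simp, by simp⟩
  | insert i s hi ih =>
    simp only [Finset.prod_insert hi, Finset.sum_insert hi]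
    exact (hf i).mul ih

theorem comp_half (hf : HasExpRate f L) : HasExpRate (fun κ => f (κ / 2)) (L / 2) := by
  have ht : Tendsto (fun κ : ℝ => κ / 2) atTop atTop := tendsto_id.atTop_div_const two_pos
  refine ⟨ht.eventually hf.1, ((hf.2.comp ht).div_const 2).congr fun κ => ?_⟩
  simp only [Function.comp_apply]
  rw [div_div, div_mul_cancel₀ _ (two_ne_zero' ℝ)]

/-- A function decays exponentially exactly when its nonpositive exponential rate is negative. -/
theorem decaysExponentially_iff (hf : HasExpRate f L) : DecaysExponentially f ↔ L < 0 := by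
  constructor
  · rintro ⟨ε, hε, hO⟩
    obtain ⟨C, hC, hb⟩ := hO.exists_pos
    have hlim : Tendsto (fun κ : ℝ => Real.log C / κ - ε) atTop (𝓝 (0 - ε)) :=
      (tendsto_const_nhds.div_atTop tendsto_id).sub_const ε
    have : L ≤ 0 - ε := by
      refine le_of_tendsto_of_tendsto hf.2 hlim ?_
      filter_upwards [hb.bound, hf.1, eventually_gt_atTop 0] with κ h1 h2 h3
      rw [Real.norm_eq_abs, Real.abs_exp] at h1
      have h4 := Real.log_le_log (norm_pos_iff.mpr h2) h1
      rw [Real.log_mul hC.ne' (Real.exp_pos _).ne', Real.log_exp] at h4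
      rw [div_le_iff₀ h3, sub_mul, div_mul_cancel₀ _ h3.ne']
      linarith
    linarith
  · intro hL
    -- Any `ε` in `(0, -L)` would do: the rate is eventually at most `-ε`.
    refine ⟨-L / 2, by linarith, Asymptotics.IsBigO.of_bound 1 ?_⟩
    filter_upwards [hf.1, eventually_gt_atTop 0,
      hf.2.eventually_le_const (show L < L / 2 by linarith)] with κ h1 h2 h3
    rw [div_le_iff₀ h2] at h3
    rw [one_mul, Real.norm_eq_abs, Real.abs_exp, ← Real.log_le_iff_le_exp (norm_pos_iff.mpr h1)]
    linarith

end HasExpRate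

/-- The exponential rate of `(w q ^ a; q)_∞`, with `q = exp (-1 / κ)` and `|w| = 1`. -/
theorem hasExpRate_qPoch {w : ℂ} (hw : ‖w‖ = 1) {a : ℝ} (ha : 0 < a) {S : ℝ}
    (hS : HasSum (fun k : ℕ => (w ^ k).re / (k : ℝ) ^ 2) S) :
    HasExpRate (fun κ : ℝ => qPoch (w * Complex.exp ((a : ℂ) * ((-1 / κ : ℝ) : ℂ)))
      (Complex.exp ((-1 / κ : ℝ) : ℂ))) (-S) := by
  have key : ∀ᶠ κ : ℝ in atTop, qPoch (w * Complex.exp ((a : ℂ) * ((-1 / κ : ℝ) : ℂ)))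
      (Complex.exp ((-1 / κ : ℝ) : ℂ)) =
      Complex.exp (-∑' k : ℕ, κ * ((expWeight a (k / κ) : ℝ) * (w ^ k / (k : ℂ) ^ 2))) := by
    filter_upwards [eventually_gt_atTop 0] with κ hκ
    have hneg : -1 / κ < 0 := div_neg_of_neg_of_pos (by norm_num) hκ
    rw [qPoch_eq_exp]
    · congr 2
      refine tsum_congr fun k => ?_
      rcases Nat.eq_zero_or_pos k with rfl | hk
      · simp
      · have hk0 : (k : ℂ) ≠ 0 := by exact_mod_cast hk.ne'
        have hκ0 : (κ : ℂ) ≠ 0 := by exact_mod_cast hκ.ne'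
        rw [mul_pow, ← Complex.exp_nat_mul, ← Complex.exp_nat_mul, expWeight]
        push_cast
        rw [show (k : ℂ) * (a * (-1 / κ)) = -(a * (k / κ)) by ring,
          show (k : ℂ) * (-1 / κ) = -(k / κ) by ring]
        generalize Complex.exp (-(a * (k / κ) : ℂ)) = A
        generalize (1 - Complex.exp (-(k / κ : ℂ))) = B
        rcases eq_or_ne B 0 with rfl | hB
        · simp
        · field_simp
    · rw [norm_mul, hw, one_mul, Complex.norm_exp, ← Complex.ofReal_mul, Complex.ofReal_re,
        Real.exp_lt_one_iff]
      exact mul_neg_of_pos_of_neg ha hneg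
    · rw [Complex.norm_exp, Complex.ofReal_re, Real.exp_lt_one_iff]
      exact hneg
  refine ⟨key.mono fun κ h => h.trans_ne (Complex.exp_ne_zero _), ?_⟩
  have hbase : Summable (fun k : ℕ => 1 / (k : ℝ) ^ 2) :=
    Real.summable_one_div_nat_pow.mpr one_lt_two
  have hnorm : ∀ k : ℕ, ‖w ^ k / (k : ℂ) ^ 2‖ = 1 / (k : ℝ) ^ 2 := fun k => by
    simp [hw]
  have hw_sum : Summable (fun k : ℕ => w ^ k / (k : ℂ) ^ 2) :=
    Summable.of_norm (by simpa only [hnorm] using hbase)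
  -- Tannery's theorem: each weight tends to `1`, and the factor `1 / k ^ 2` gives a summable
  -- majorant even though `|w| = 1`.
  have hlim : Tendsto (fun κ : ℝ => ∑' k : ℕ, ((expWeight a (k / κ) : ℝ) * (w ^ k / (k : ℂ) ^ 2)))
      atTop (𝓝 (∑' k : ℕ, w ^ k / (k : ℂ) ^ 2)) := by
    refine tendsto_tsum_of_dominated_convergence (hbase.mul_left (1 + 1 / a)) (fun k => ?_) ?_
    · rcases Nat.eq_zero_or_pos k with rfl | hk
      · simp
      · have hk0 : (0 : ℝ) < k := by exact_mod_cast hk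
        have h0 : Tendsto (fun κ : ℝ => (k : ℝ) / κ) atTop (𝓝[>] 0) :=
          tendsto_nhdsWithin_iff.mpr ⟨tendsto_const_nhds.div_atTop tendsto_id, by
            filter_upwards [eventually_gt_atTop 0] with κ hκ using div_pos hk0 hκ⟩
        have h1 := (Complex.continuous_ofReal.tendsto 1).comp ((tendsto_expWeight a).comp h0)
        simpa using h1.mul_const (w ^ k / (k : ℂ) ^ 2)
    · filter_upwards [eventually_gt_atTop 0] with κ hκ k
      rcases Nat.eq_zero_or_pos k with rfl | hk
      · simp
      · have hk0 : (0 : ℝ) < k := by exact_mod_cast hk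
        rw [norm_mul, hnorm, Complex.norm_real, Real.norm_eq_abs]
        gcongr
        exact abs_expWeight_le ha (div_pos hk0 hκ)
  have hre : (∑' k : ℕ, w ^ k / (k : ℂ) ^ 2).re = S := by
    rw [Complex.re_tsum hw_sum, ← hS.tsum_eq]
    refine tsum_congr fun k => ?_
    rw [← Nat.cast_pow, Complex.div_natCast_re, Nat.cast_pow]
  have h2 := ((Complex.continuous_re.tendsto _).comp hlim).neg
  rw [hre] at h2
  refine h2.congr' ?_
  filter_upwards [key, eventually_gt_atTop 0] with κ h hκ
  rw [h, Complex.norm_exp, Real.log_exp, tsum_mul_left, Complex.neg_re, Complex.re_ofReal_mul,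
    neg_div, mul_div_cancel_left₀ _ hκ.ne', Function.comp_apply]

/-! ### The dilogarithm on the circle and the rates of the factors -/

/-- The real part of the dilogarithm on the unit circle. -/
theorem hasSum_re_pow_div_sq (θ : ℝ) (hθ : |θ| ≤ 2 * Real.pi) :
    HasSum (fun k : ℕ => (Complex.exp (θ * Complex.I) ^ k).re / (k : ℝ) ^ 2)
      (Real.pi ^ 2 / 6 - Real.pi * |θ| / 2 + θ ^ 2 / 4) := by
  have hπ := Real.pi_pos
  have hx : |θ| / (2 * Real.pi) ∈ Set.Icc (0 : ℝ) 1 :=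
    ⟨by positivity, (div_le_one (by positivity)).mpr hθ⟩
  -- Fourier series of the Bernoulli polynomial `B₂` at `|θ| / (2π)`.
  have h := hasSum_one_div_nat_pow_mul_cos one_ne_zero hx
  have hB : (Polynomial.map (algebraMap ℚ ℝ) (Polynomial.bernoulli (2 * 1))).eval
      (|θ| / (2 * Real.pi)) = (|θ| / (2 * Real.pi)) ^ 2 - |θ| / (2 * Real.pi) + 6⁻¹ := by
    simpa [bernoulliFun] using bernoulliFun_two (|θ| / (2 * Real.pi))
  rw [hB] at h
  convert h using 1
  · ext k
    rw [← Complex.exp_nat_mul, ← mul_assoc, ← Complex.ofReal_natCast, ← Complex.ofReal_mul,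
      Complex.exp_ofReal_mul_I_re, ← Real.cos_abs, abs_mul, Nat.abs_cast,
      show 2 * Real.pi * k * (|θ| / (2 * Real.pi)) = k * |θ| by field_simp]
    ring
  · have hsq := sq_abs θ
    norm_num [Nat.factorial]
    field_simp
    linear_combination (-24) * hsq

theorem Circle.coe_eq_exp_arg (w : Circle) :
    (w : ℂ) = Complex.exp (Complex.arg (w : ℂ) * Complex.I) := by
  conv_lhs => rw [← Complex.norm_mul_exp_arg_mul_I (w : ℂ), Circle.norm_coe, Complex.ofReal_one,
    one_mul]

theorem Circle.hasSum_re_pow_div_sq (w : Circle) :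
    HasSum (fun k : ℕ => ((w : ℂ) ^ k).re / (k : ℝ) ^ 2)
      (Real.pi ^ 2 / 6 - Real.pi * |Complex.arg (w : ℂ)| / 2 + Complex.arg (w : ℂ) ^ 2 / 4) := by
  have := _root_.hasSum_re_pow_div_sq (Complex.arg (w : ℂ))
    ((Complex.abs_arg_le_pi _).trans (by linarith [Real.pi_pos]))
  rwa [← Circle.coe_eq_exp_arg] at this

/-- Here `-w⁻¹ = e^{i(π - Arg w)}` with `π - Arg w` in `[0, 2π)`, so no absolute value survives. -/
theorem Circle.hasSum_re_neg_inv_pow_div_sq (w : Circle) :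
    HasSum (fun k : ℕ => ((-(w : ℂ)⁻¹) ^ k).re / (k : ℝ) ^ 2)
      (Complex.arg (w : ℂ) ^ 2 / 4 - Real.pi ^ 2 / 12) := by
  have hle := abs_le.mp (Complex.abs_arg_le_pi (w : ℂ))
  have := _root_.hasSum_re_pow_div_sq (Real.pi - Complex.arg (w : ℂ))
    (abs_le.mpr ⟨by linarith [Real.pi_pos], by linarith [Real.pi_pos]⟩)
  have he : Complex.exp ((Real.pi - Complex.arg (w : ℂ) : ℝ) * Complex.I) = -(w : ℂ)⁻¹ := by
    rw [Complex.ofReal_sub, sub_mul, Complex.exp_sub, Complex.exp_pi_mul_I,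
      ← Circle.coe_eq_exp_arg, div_eq_mul_inv, neg_one_mul]
  rw [he, abs_of_nonneg (by linarith)] at this
  convert this using 1
  ring

theorem hasExpRate_GFun (w : Circle) {a : ℝ} (h0 : 0 < a) (h1 : a < 1) :
    HasExpRate (fun κ : ℝ => GFun (Complex.exp ((-1 / κ : ℝ) : ℂ))
      ((w : ℂ) * Complex.exp ((a : ℂ) * ((-1 / κ : ℝ) : ℂ))))
      (Real.pi ^ 2 / 4 - Real.pi / 2 * |Complex.arg (w : ℂ)|) := by
  have hnum := hasExpRate_qPoch (w := -(w : ℂ)⁻¹)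
    (by rw [norm_neg, norm_inv, Circle.norm_coe, inv_one]) (sub_pos.mpr h1)
    w.hasSum_re_neg_inv_pow_div_sq
  have hden := hasExpRate_qPoch (w := (w : ℂ)) w.norm_coe h0 w.hasSum_re_pow_div_sq
  convert hnum.div hden using 1
  · ext κ
    rw [GFun]
    congr 2
    rw [mul_inv, ← Complex.exp_neg]
    push_cast
    rw [sub_mul, one_mul, sub_eq_add_neg, Complex.exp_add]
    ring
  · ring

theorem hasExpRate_cConst :
    HasExpRate (fun κ : ℝ => cConst (Complex.exp ((-1 / κ : ℝ) : ℂ))) (-(Real.pi ^ 2 / 4)) := by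
  have hS : HasSum (fun k : ℕ => ((1 : ℂ) ^ k).re / (k : ℝ) ^ 2) (Real.pi ^ 2 / 6) := by
    simpa using hasSum_zeta_two
  have h1 := hasExpRate_qPoch (w := 1) norm_one one_pos hS
  simp only [one_mul, Complex.ofReal_one] at h1
  -- Squaring `q` replaces `κ` by `κ / 2`.
  convert (h1.pow 2).div h1.comp_half using 1
  · ext κ
    rw [cConst, ← Complex.exp_nat_mul]
    congr 3 <;> · push_cast; ring
  · push_cast; ring

/-- The exponential rate of the state integrand is a sum of local contributions. -/
theorem hasExpRate_stateIntegrand {N : ℕ} (a : OrientedGluing.Quad N → ℝ)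
    (ω : OrientedGluing.Quad N → Circle) (ha : ∀ s, 0 < a s ∧ a s < 1) :
    HasExpRate (fun κ : ℝ => stateIntegrand a ω ((-1 / κ : ℝ) : ℂ))
      (Real.pi / 2 * ∑ t : Fin N, (Real.pi - ∑ i : Fin 3, |Complex.arg (ω (t, i) : ℂ)|)) := by
  convert (hasExpRate_cConst.pow N).mul (HasExpRate.prod Finset.univ
    fun s => hasExpRate_GFun (ω s) (ha s).1 (ha s).2) using 1
  · rfl
  · rw [Fintype.sum_prod_type]
    simp only [Finset.sum_sub_distrib, ← Finset.mul_sum, Finset.sum_const, Finset.card_univ,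
      Fintype.card_fin, nsmul_eq_mul]
    push_cast
    ring

/-! ### Arguments in an angled tetrahedron -/

/-- The arguments of an angled tetrahedron sum to an odd multiple of `π`. -/
theorem IsAngledTetrahedron.exists_sum_arg {θ : Fin 3 → Circle} (h : IsAngledTetrahedron θ) :
    ∃ m : ℤ, ∑ i, Complex.arg (θ i : ℂ) = (2 * m + 1) * Real.pi := by
  have h1 : Circle.exp (∑ i, Complex.arg (θ i : ℂ)) = Circle.exp Real.pi := by
    ext
    rw [Circle.coe_exp, Circle.coe_exp, Complex.exp_pi_mul_I, ← h, Complex.ofReal_sum,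
      Finset.sum_mul, Complex.exp_sum]
    exact Finset.prod_congr rfl fun i _ => ((θ i).coe_eq_exp_arg).symm
  obtain ⟨m, hm⟩ := Circle.exp_eq_exp.mp h1
  exact ⟨m, by rw [hm]; ring⟩

/-- The asymmetry comes from `Arg` taking values in `(-π, π]`: `3π` is attainable, `-3π` is not. -/
theorem IsAngledTetrahedron.sum_arg_eq {θ : Fin 3 → Circle} (h : IsAngledTetrahedron θ) :
    ∑ i, Complex.arg (θ i : ℂ) = Real.pi ∨ ∑ i, Complex.arg (θ i : ℂ) = -Real.pi ∨
      ∑ i, Complex.arg (θ i : ℂ) = 3 * Real.pi := by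
  obtain ⟨m, hm⟩ := h.exists_sum_arg
  have hπ := Real.pi_pos
  have hlo : -(3 * Real.pi) < ∑ i, Complex.arg (θ i : ℂ) := by
    rw [Fin.sum_univ_three]
    linarith [Complex.neg_pi_lt_arg (θ 0 : ℂ), Complex.neg_pi_lt_arg (θ 1 : ℂ),
      Complex.neg_pi_lt_arg (θ 2 : ℂ)]
  have hhi : ∑ i, Complex.arg (θ i : ℂ) ≤ 3 * Real.pi := by
    rw [Fin.sum_univ_three]
    linarith [Complex.arg_le_pi (θ 0 : ℂ), Complex.arg_le_pi (θ 1 : ℂ),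
      Complex.arg_le_pi (θ 2 : ℂ)]
  rw [hm] at hlo hhi ⊢
  have h1 : (-2 : ℝ) < m := by nlinarith
  have h2 : (m : ℝ) < 2 := by nlinarith
  have h1' : -2 < m := by exact_mod_cast h1
  have h2' : m < 2 := by exact_mod_cast h2
  interval_cases m
  · right; left; push_cast; ring
  · left; push_cast; ring
  · right; right; push_cast; ring

theorem IsAngledTetrahedron.pi_le_sum_abs_arg {θ : Fin 3 → Circle} (h : IsAngledTetrahedron θ) :
    Real.pi ≤ ∑ i, |Complex.arg (θ i : ℂ)| := by
  have hπ := Real.pi_pos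
  refine le_trans ?_ (Finset.abs_sum_le_sum_abs _ _)
  rcases h.sum_arg_eq with h | h | h <;> rw [h, le_abs]
  · left; rfl
  · right; linarith
  · left; linarith

theorem Circle.im_pos_iff_arg (w : Circle) :
    0 < (w : ℂ).im ↔ 0 < Complex.arg (w : ℂ) ∧ Complex.arg (w : ℂ) < Real.pi := by
  rw [Complex.arg_lt_pi_iff]
  constructor
  · intro h
    refine ⟨lt_of_le_of_ne (Complex.arg_nonneg_iff.mpr h.le) fun h0 => ?_, Or.inr h.ne'⟩
    exact h.ne' (Complex.arg_eq_zero_iff.mp h0.symm).2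
  · rintro ⟨h1, h2⟩
    refine lt_of_le_of_ne (Complex.arg_nonneg_iff.mp h1.le) fun h0 => ?_
    rcases h2 with h2 | h2
    · exact h1.ne' (Complex.arg_eq_zero_iff.mpr ⟨h2, h0.symm⟩)
    · exact h2 h0.symm

/-- If no argument vanishes, total `π` forces equality in the triangle inequality, hence a common
sign, and no argument can reach `π`. If one vanishes, the other two add to `±π` with each at most
`π` in modulus, so they cannot have opposite signs. -/
theorem IsAngledTetrahedron.sum_abs_arg_eq_pi_iff {θ : Fin 3 → Circle}
    (h : IsAngledTetrahedron θ) :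
    ∑ i, |Complex.arg (θ i : ℂ)| = Real.pi ↔ NonSuppressing θ := by
  have hπ := Real.pi_pos
  have hsum := h.sum_arg_eq
  have hlo : ∀ i, -Real.pi < Complex.arg (θ i : ℂ) := fun i => Complex.neg_pi_lt_arg _
  have hhi : ∀ i, Complex.arg (θ i : ℂ) ≤ Real.pi := fun i => Complex.arg_le_pi _
  simp only [NonSuppressing, ← Circle.arg_eq_zero, Circle.im_pos_iff_arg, ← Complex.arg_neg_iff,
    Fin.exists_fin_succ, Fin.forall_fin_succ, Fin.sum_univ_three] at hsum hlo hhi ⊢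
  simp only [Fin.succ_zero_eq_one, Fin.succ_one_eq_two, IsEmpty.exists_iff, IsEmpty.forall_iff,
    or_false, and_true] at hlo hhi ⊢
  obtain ⟨l0, l1, l2⟩ := hlo
  obtain ⟨u0, u1, u2⟩ := hhi
  generalize Complex.arg (θ 0 : ℂ) = x at *
  generalize Complex.arg (θ 1 : ℂ) = y at *
  generalize Complex.arg (θ 2 : ℂ) = z at *
  constructor
  · intro habs
    by_contra hns
    simp only [not_or] at hns
    obtain ⟨⟨hx, hy, hz⟩, hpos, hneg⟩ := hns
    have hx' := abs_pos.mpr hx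
    have hy' := abs_pos.mpr hy
    have hz' := abs_pos.mpr hz
    rcases hsum with h | h | h
    · refine hpos ⟨⟨?_, ?_⟩, ⟨?_, ?_⟩, ?_, ?_⟩ <;> grind
    · refine hneg ⟨?_, ?_, ?_⟩ <;> grind
    · linarith [le_abs_self x, le_abs_self y, le_abs_self z]
  · rintro (h | ⟨⟨hx, hx'⟩, ⟨hy, hy'⟩, hz, hz'⟩ | ⟨hx, hy, hz⟩)
    · grind
    · rw [abs_of_pos hx, abs_of_pos hy, abs_of_pos hz]
      rcases hsum with h | h | h <;> linarith
    · rw [abs_of_neg hx, abs_of_neg hy, abs_of_neg hz]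
      rcases hsum with h | h | h <;> linarith

theorem IsAngledTetrahedron.pi_lt_sum_abs_arg_iff {θ : Fin 3 → Circle}
    (h : IsAngledTetrahedron θ) :
    Real.pi < ∑ i, |Complex.arg (θ i : ℂ)| ↔ Suppressing θ := by
  rw [Suppressing, ← h.sum_abs_arg_eq_pi_iff, h.pi_le_sum_abs_arg.lt_iff_ne, ne_comm]

theorem mainTheorem9 :
    (∀ (N : ℕ) (T : IdealTriangulation N) (ω : OrientedGluing.Quad N → Circle),
      ω ∈ T.circleAngleStructures →
      ∀ a : OrientedGluing.Quad N → ℝ, (∀ s, 0 < a s ∧ a s < 1) →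
        (DecaysExponentially (fun κ : ℝ => stateIntegrand a ω ((-1 / κ : ℝ) : ℂ)) ↔
          ∃ t : Fin N, Suppressing (fun i => ω (t, i)))) ∧
    (∀ θ : Fin 3 → Circle, IsAngledTetrahedron θ →
      Real.pi ≤ ∑ i, |Complex.arg (θ i : ℂ)| ∧
      (Real.pi < ∑ i, |Complex.arg (θ i : ℂ)| ↔ Suppressing θ)) := by
  refine ⟨fun N T ω hω a ha => ?_, fun θ hθ => ⟨hθ.pi_le_sum_abs_arg, hθ.pi_lt_sum_abs_arg_iff⟩⟩
  rw [(hasExpRate_stateIntegrand a ω ha).decaysExponentially_iff,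
    ← neg_pos, ← mul_neg, mul_pos_iff_of_pos_left (half_pos Real.pi_pos), neg_pos, Finset.sum_neg_iff_of_nonpos
      fun t _ => sub_nonpos.mpr (hω.1 t).pi_le_sum_abs_arg]
  simp only [Finset.mem_univ, true_and, sub_neg]
  exact exists_congr fun t => (hω.1 t).pi_lt_sum_abs_arg_iff
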